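/- Let $L$ be a first-order language and let $\mathbb M$ be a large saturated model of a complete $L$-theory: $|\mathbb M|>\aleph_0+|L|$, and every set of formulas in finitely many variables, with fewer than $|\mathbb M|$ parameters, that is finitely satisfiable in $\mathbb M$ is realized in $\mathbb M$. A set $A\subseteq\mathbb M$ is small if $|A|<|\mathbb M|$. Fix a small set $A$, a natural number $n$ and a complete type $p\in S_n(A)$, and let $p(\mathbb M)\subseteq\mathbb M^n$ be its set of realizations. A relation on $p(\mathbb M)$ is relatively $B$-definable if it is the trace on $p(\mathbb M)$ of a $B$-definable relation on $\mathbb M^n$, and relatively definable if it is relatively $B$-definable for some $B\subseteq\mathbb M$. Let $<_p$ be a linear order on $p(\mathbb M)$. A subset of $p(\mathbb M)$ is left-eventual (right-eventual) if it contains a non-empty initial (final) part of $(p(\mathbb M),<_p)$. The pair $\mathbf p=(p,<_p)$ is an so-pair over $A$ if $<_p$ is relatively $A$-definable and, for every relatively definable $D\subseteq p(\mathbb M)$, exactly one of $D$ and $p(\mathbb M)\smallsetminus D$ is left-eventual and exactly one of them is right-eventual. Its right globalization $\mathbf p_r$ is the set of all formulas $\phi(x)$ with parameters in $\mathbb M$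 such that $\phi(\mathbb M)\cap p(\mathbb M)$ is right-eventual. For $a,b\in p(\mathbb M)$ write $a\triangleleft^{\mathbf p}b$ ($b$ is right $\mathbf p$-generic over $a$) if $b$ realizes the restriction of $\mathbf p_r$ to parameters from $Aa$. Let $\mathcal D_p$ be the set of all $(a,b)\in p(\mathbb M)^2$ such that $\operatorname{tp}(a/Ab)$ forks over $A$. **Theorem.** Let $\mathbf p=(p,<_p)$ be an so-pair over $A$ such that $p$ is non-algebraic, i.e. $p(\mathbb M)$ is infinite. Then: (i) $(p(\mathbb M),\triangleleft^{\mathbf p})$ is a strict partial order, and the linear order $(p(\mathbb M),<_p)$ extends it: $a\triangleleft^{\mathbf p}b$ implies $a<_pb$. (ii) For all $a,b\in p(\mathbb M)$, $(a,b)\in\mathcal D_p$ if and only if $a$ and $b$ are $\triangleleft^{\mathbf p}$-incomparable (neither $a\triangleleft^{\mathbf p}b$ nor $b\triangleleft^{\mathbf p}a$). This relation is an equivalence relation on $p(\mathbb M)$ all of whose classes are $<_p$-convex. The quotient $p(\mathbb M)/\mathcal D_p$, with the order in which $Y<Z$ if and only if $y<_pz$ for all $y\in Y$ and $z\in Z$,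 is a dense linear order with more than one element. -/

import Mathlib

universe u v w

open FirstOrder Cardinal

namespace SoType


/-! ### Linear orders given by their strict part -/

section Orders

variable {X : Type*}

/-- `I` is an initial part of `(X, <)`. -/
def IsInitialPart (lt : X → X → Prop) (I : Set X) : Prop :=
  ∀ a ∈ I, ∀ b, lt b a → b ∈ I

/-- `I` is a final part of `(X, <)`. -/
def IsFinalPart (lt : X → X → Prop) (I : Set X) : Prop :=
  ∀ a ∈ I, ∀ b, lt a b → b ∈ I

/-- `D` contains a non-empty initial part of `(X, <)`. -/
def LeftEventual (lt : X → X → Prop) (D : Set X) : Prop :=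
  ∃ I : Set X, I ⊆ D ∧ I.Nonempty ∧ IsInitialPart lt I

/-- `D` contains a non-empty final part of `(X, <)`. -/
def RightEventual (lt : X → X → Prop) (D : Set X) : Prop :=
  ∃ I : Set X, I ⊆ D ∧ I.Nonempty ∧ IsFinalPart lt I

/-- `D` is a convex subset of `(X, <)`. -/
def IsConvexPart (lt : X → X → Prop) (D : Set X) : Prop :=
  ∀ a ∈ D, ∀ b ∈ D, ∀ c, lt a c → lt c b → c ∈ D

/-- All classes of `E` are convex in `(X, <)`. -/
def IsConvexRel (lt : X → X → Prop) (E : X → X → Prop) : Prop :=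
  ∀ x, IsConvexPart lt {y | E x y}

/-- The relation induced by `<` on the classes of a setoid: `Y < Z` when every element of `Y` is
below every element of `Z`. -/
def quotientLT (lt : X → X → Prop) (s : Setoid X) (Y Z : Quotient s) : Prop :=
  ∀ y z : X, Quotient.mk s y = Y → Quotient.mk s z = Z → lt y z

end Orders

variable (L : FirstOrder.Language.{u, v}) {M : Type w} [L.Structure M]

/-! ### Saturated models, types and their loci -/

/-- `M` is a large saturated structure: it is uncountable, has more elements than the language has
symbols, and realizes every set of formulas in finitely many variables with fewer than `|M|`
parameters that is finitely satisfiable in `M`. -/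
structure IsMonster (M : Type w) [L.Structure M] : Prop where
  uncountable : ℵ₀ < #M
  card_language_lt : Cardinal.lift.{w} L.card < Cardinal.lift.{max u v} #M
  saturated : ∀ (n : ℕ) (C : Set M), #C < #M → ∀ Γ : Set (L[[C]].Formula (Fin n)),
    (∀ Γ₀ : Finset (L[[C]].Formula (Fin n)), (Γ₀ : Set (L[[C]].Formula (Fin n))) ⊆ Γ →
      ∃ a : Fin n → M, ∀ φ ∈ Γ₀, φ.Realize a) →
    ∃ a : Fin n → M, ∀ φ ∈ Γ, φ.Realize a

/-- Complete `n`-types over a set of parameters `A ⊆ M`. -/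
abbrev TypeOver (A : Set M) (n : ℕ) := (L[[A]].completeTheory M).CompleteType (Fin n)

variable {L}

/-- The set `p(M)` of realizations of `p` in `M`. -/
def locus {A : Set M} {n : ℕ} (p : TypeOver L A n) : Set (Fin n → M) :=
  {a | ∀ φ : L[[A]].Formula (Fin n), FirstOrder.Language.Formula.equivSentence φ ∈ p → φ.Realize a}

/-- A type is non-algebraic if it has infinitely many realizations in the saturated model. -/
def NonAlgebraic {A : Set M} {n : ℕ} (p : TypeOver L A n) : Prop :=
  (locus p).Infinite

/-- `X ⊆ P` is relatively `B`-definable within `P`. -/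
def RelDefinable (L : FirstOrder.Language.{u, v}) {M : Type w} [L.Structure M] {n : ℕ} (B : Set M)
    {P : Set (Fin n → M)} (X : Set P) : Prop :=
  ∃ D : Set (Fin n → M), B.Definable L D ∧ X = {a : P | (a : Fin n → M) ∈ D}

/-- The binary relation `R` on `P` is relatively `B`-definable within `P × P`. -/
def RelDefinableRel (L : FirstOrder.Language.{u, v}) {M : Type w} [L.Structure M] {n : ℕ} (B : Set M)
    {P : Set (Fin n → M)} (R : P → P → Prop) : Prop :=
  ∃ D : Set (Fin n ⊕ Fin n → M), B.Definable L D ∧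
    ∀ a b : P, R a b ↔ Sum.elim (a : Fin n → M) (b : Fin n → M) ∈ D

/-- `(p, <)` is a stationarily ordered pair over `A`. -/
structure IsSoPair {A : Set M} {n : ℕ} (p : TypeOver L A n)
    (lt : locus p → locus p → Prop) : Prop where
  linear : IsStrictTotalOrder (locus p) lt
  definable : RelDefinableRel L A lt
  left : ∀ D : Set (locus p), RelDefinable L (Set.univ : Set M) D →
    Xor (LeftEventual lt D) (LeftEventual lt Dᶜ)
  right : ∀ D : Set (locus p), RelDefinable L (Set.univ : Set M) D →
    Xor (RightEventual lt D) (RightEventual lt Dᶜ)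

/-! ### Genericity -/

/-- The right globalization of `(p, <)`: all formulas `φ(x)` with parameters in `M` such that
`φ(M) ∩ p(M)` is right-eventual in `(p(M), <)`. -/
def rightGlobalization {A : Set M} {n : ℕ} (p : TypeOver L A n)
    (lt : locus p → locus p → Prop) : Set (L[[(Set.univ : Set M)]].Formula (Fin n)) :=
  {φ | RightEventual lt {a : locus p | φ.Realize (a : Fin n → M)}}

/-- The restriction to parameters from `C` of a set of formulas with parameters from `M`. -/
def restrictParams {n : ℕ} (π : Set (L[[(Set.univ : Set M)]].Formula (Fin n))) (C : Set M) :
    Set (L[[C]].Formula (Fin n)) :=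
  {φ | (L.lhomWithConstantsMap (Set.inclusion (Set.subset_univ C))).onFormula φ ∈ π}

/-- `a` is right generic over `B` with respect to `(p, <)`: it realizes the restriction of the
right globalization to `A ∪ B`. -/
def RightGeneric {A : Set M} {n : ℕ} (p : TypeOver L A n) (lt : locus p → locus p → Prop)
    (B : Set M) (a : locus p) : Prop :=
  ∀ φ ∈ restrictParams (rightGlobalization p lt) (A ∪ B), φ.Realize (a : Fin n → M)

/-- Right genericity as a binary relation `a ◁ b` on `p(M)`: `b` is right generic over `a`. -/
def Triangle {A : Set M} {n : ℕ} (p : TypeOver L A n) (lt : locus p → locus p → Prop)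
    (a b : locus p) : Prop :=
  RightGeneric p lt (Set.range (a : Fin n → M)) b

/-- Incomparability with respect to a strict partial order. -/
def Incomparable {X : Type*} (r : X → X → Prop) (a b : X) : Prop :=
  ¬ r a b ∧ ¬ r b a

/-! ### Forking -/

/-- `b` and `c` have the same type over `A`. -/
def SameType (L : FirstOrder.Language.{u, v}) {M : Type w} [L.Structure M] {m : ℕ} (A : Set M)
    (b c : Fin m → M) : Prop :=
  ∀ ψ : L[[A]].Formula (Fin m), ψ.Realize b ↔ ψ.Realize c

/-- The formula `φ(x, b)` divides over `A`: for some `k` there is a sequence of realizations `c i`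
of `tp(b/A)` such that the family of formulas `φ(x, c i)` is `k`-inconsistent. -/
def Divides {n m : ℕ} (A : Set M) (φ : L.Formula (Fin n ⊕ Fin m)) (b : Fin m → M) : Prop :=
  ∃ (c : ℕ → Fin m → M) (k : ℕ), (∀ i, SameType L A b (c i)) ∧
    ∀ s : Finset ℕ, s.card = k → ¬ ∃ x : Fin n → M, ∀ i ∈ s, φ.Realize (Sum.elim x (c i))

/-- The partial type `π` over a small set `C` forks over `A`: it implies a finite disjunction of
formulas with parameters from `M` each of which divides over `A`. As `M` is saturated and `C` is
small, the implication may be tested on tuples from `M`. -/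
def Forks {n : ℕ} (A : Set M) {C : Set M} (π : Set (L[[C]].Formula (Fin n))) : Prop :=
  ∃ (N : ℕ) (m : Fin N → ℕ) (φ : ∀ j, L.Formula (Fin n ⊕ Fin (m j)))
    (b : ∀ j, Fin (m j) → M),
    (∀ j, Divides A (φ j) (b j)) ∧
    ∀ x : Fin n → M, (∀ ψ ∈ π, ψ.Realize x) → ∃ j, (φ j).Realize (Sum.elim x (b j))

/-- The type of the tuple `a` over `C`, as a set of formulas. -/
def tp (L : FirstOrder.Language.{u, v}) {M : Type w} [L.Structure M] {n : ℕ} (C : Set M) (a : Fin n → M) :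
    Set (L[[C]].Formula (Fin n)) :=
  {ψ | ψ.Realize a}

/-- `a` depends on `B` over `A`: the type of `a` over `A ∪ B` forks over `A`. -/
def ForkDependent (L : FirstOrder.Language.{u, v}) {M : Type w} [L.Structure M] {n : ℕ} (A : Set M)
    (a : Fin n → M) (B : Set M) : Prop :=
  Forks A (tp L (A ∪ B) a)

/-- Forking dependence over `A` as a binary relation on `p(M)`. -/
def ForkRel {A : Set M} {n : ℕ} (p : TypeOver L A n) (a b : locus p) : Prop :=
  ForkDependent L A (a : Fin n → M) (Set.range (b : Fin n → M))

end SoType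

/-!
Everything is phrased with `A`-definable sets instead of formulas: a set definable over `A` and a
finite tuple `c` is a fibre at `c` of an `A`-definable set `S`, and the right globalization consists
of the `(S, c)` whose fibre is right-eventual in the locus. Saturation enters as compactness:
quantifiers over the locus may be replaced by quantifiers over some `A`-definable set containing it
(`IsMonster.exists_definable_superset`).

Compactness turns a right-eventual fibre into a final one, uniformly in the parameter
(`IsLargeSoPair.exists_final_subfamily`). So the right globalization is `A`-invariant
(`IsLargeSoPair.rightEventual_of_typeEq`), and `a ◁ b < c` implies `a ◁ c`. The key point is
`IsLargeSoPair.leftEventual_converse`: if the fibres `T a` are non-empty final parts lying above `a`,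
then each `c` lies in `T a` for all small `a`. Otherwise all `a < d` would have `c ∉ T a` for some
`d`; but `min c d` lies in some `T a`, whence `a < d` and `c ∈ T a` because `T a` is final. Applying
this to the order and then to its reverse, every relation that is right-eventual in its first
argument contains one that is also decreasing in the second
(`IsLargeSoPair.exists_decreasing_subrelation`). It follows that `a < b ◁ c` implies `a ◁ c`, and
that `a ◁ b` says as well that `a` is left generic over `b` (`IsLargeSoPair.triangle_reverse`).

Relations that are right-eventual in the first argument are closed under composition
(`Triangle.exists_comp`). If `a ◁ c`, composing a relation refuting `a ◁ b` with one refuting `b ◁ c`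
contradicts genericity, so `◁` is negatively transitive and incomparability is an equivalence
relation; saturation applied to the same composites gives density.

As for forking: if `b ◁ a`, then `tp(a/Ab)` extends to an `A`-invariant global type, which contains
no dividing formula; the case `a ◁ b` is the same for the reversed order. If `a` and `b` are
incomparable, pick `α` left generic and `β` right generic over `b`. All realizations of `tp(a/Ab)`
lie between `α` and `β`, and an interval of the locus divides over `A`, since it has infinitely many
pairwise disjoint conjugates (`IsLargeSoPair.exists_disjoint_conjugates`).
-/

namespace SoType

/-! ### Definable sets, parameters and types -/

section Definability

variable {L : FirstOrder.Language.{u, v}} {M : Type w} [L.Structure M]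

open FirstOrder.Language

/-- The sets definable over `A` together with the entries of a tuple `c` are the fibres at `c` of
the `A`-definable sets. -/
theorem definable_union_range_iff {A : Set M} {α β : Type*} (c : β → M) {X : Set (α → M)} :
    (A ∪ Set.range c).Definable L X ↔
      ∃ S : Set (α ⊕ β → M), A.Definable L S ∧ X = {x | Sum.elim x c ∈ S} := by
  classical
  constructor
  · intro h
    obtain ⟨φ, rfl⟩ := Set.definable_iff_exists_formula_sum.1 h
    have hg : ∀ y : ↥(A ∪ Set.range c), ∃ z : A ⊕ β, Sum.elim (fun a : A => (a : M)) c z = y := by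
      rintro ⟨y, hy | ⟨i, rfl⟩⟩
      · exact ⟨.inl ⟨y, hy⟩, rfl⟩
      · exact ⟨.inr i, rfl⟩
    choose g hg using hg
    refine ⟨{w | (φ.relabel (Sum.elim (fun y => Sum.map id Sum.inr (g y))
      (fun i => Sum.inr (Sum.inl i))) : L.Formula (A ⊕ (α ⊕ β))).Realize (Sum.elim (↑) w)},
      Set.definable_iff_exists_formula_sum.2 ⟨_, rfl⟩, ?_⟩
    ext x
    simp only [Set.mem_ofPred_eq, Formula.realize_relabel]
    refine iff_of_eq (congrArg _ ?_)
    funext z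
    rcases z with y | i
    · simp only [Sum.elim_inl, Function.comp_apply]
      rw [← hg y]
      cases g y <;> rfl
    · rfl
  · rintro ⟨S, hS, rfl⟩
    obtain ⟨φ, rfl⟩ := Set.definable_iff_exists_formula_sum.1 hS
    refine Set.definable_iff_exists_formula_sum.2
      ⟨φ.relabel (Sum.elim (fun a : A => Sum.inl ⟨(a : M), Or.inl a.2⟩)
        (Sum.elim Sum.inr (fun i => Sum.inl ⟨c i, Or.inr ⟨i, rfl⟩⟩))), ?_⟩
    ext x
    simp only [Set.mem_ofPred_eq, Formula.realize_relabel]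
    refine iff_of_eq (congrArg _ ?_)
    funext z
    rcases z with y | i | i <;> rfl

/-- Definable sets over `A` are the fibres of parameter-free ones at finite tuples from `A`. -/
theorem exists_formula_tuple {A : Set M} {α : Type*} {X : Set (α → M)} (h : A.Definable L X) :
    ∃ (k : ℕ) (d : Fin k → M) (φ : L.Formula (α ⊕ Fin k)), (∀ i, d i ∈ A) ∧
      ∀ x, x ∈ X ↔ φ.Realize (Sum.elim x d) := by
  obtain ⟨A₀, hA₀, h⟩ := Set.definable_iff_finitely_definable.1 h
  obtain ⟨φ, rfl⟩ := Set.definable_iff_exists_formula_sum.1 h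
  let e := A₀.equivFin
  refine ⟨A₀.card, fun i => (e.symm i : M),
    φ.relabel (Sum.elim (fun a => Sum.inr (e a)) Sum.inl), fun i => hA₀ (e.symm i).2, fun x => ?_⟩
  simp only [Set.mem_ofPred_eq, Formula.realize_relabel]
  refine iff_of_eq (congrArg _ ?_)
  funext z
  rcases z with y | i
  · exact congrArg Subtype.val (e.symm_apply_apply y).symm
  · rfl

/-- Projecting away the first coordinates preserves definability. -/
theorem definable_exists_left {A : Set M} {α β : Type*} [Finite α] {S : Set (α ⊕ β → M)}
    (hS : A.Definable L S) : A.Definable L {c : β → M | ∃ x : α → M, Sum.elim x c ∈ S} := by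
  have h := (hS.preimage_comp (Sum.swap : α ⊕ β → β ⊕ α)).exists_of_finite
  convert h using 3 with c
  refine exists_congr fun x => ?_
  rw [Set.mem_preimage]
  refine iff_of_eq (congrArg (· ∈ S) ?_)
  funext z
  rcases z with z | z <;> rfl

/-- Two tuples with the same type over `A`, expressed through `A`-definable sets. -/
def TypeEq (L : FirstOrder.Language.{u, v}) [L.Structure M] (A : Set M) {β : Type*}
    (b c : β → M) : Prop :=
  ∀ S : Set (β → M), A.Definable L S → (b ∈ S ↔ c ∈ S)

theorem typeEq_of_imp {A : Set M} {β : Type*} {b c : β → M}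
    (h : ∀ S : Set (β → M), A.Definable L S → b ∈ S → c ∈ S) : TypeEq L A b c :=
  fun S hS => ⟨h S hS, fun hc => by_contra fun hb => h Sᶜ hS.compl hb hc⟩

theorem sameType_iff_typeEq {A : Set M} {m : ℕ} {b c : Fin m → M} :
    SameType L A b c ↔ TypeEq L A b c :=
  ⟨fun h S ⟨φ, hφ⟩ => by subst hφ; exact h φ, fun h φ => h {x | φ.Realize x} ⟨φ, rfl⟩⟩

theorem TypeEq.comp {A : Set M} {β γ : Type*} {b c : β → M} (h : TypeEq L A b c) (f : γ → β) :
    TypeEq L A (b ∘ f) (c ∘ f) :=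
  fun _ hS => h _ (hS.preimage_comp f)

end Definability

/-! ### Saturation for definable sets -/

section Saturation

variable {L : FirstOrder.Language.{u, v}} {M : Type w} [L.Structure M]

open FirstOrder.Language

/-- Saturation for definable sets: a downward directed family of non-empty sets definable over a
small set has a common point. -/
theorem IsMonster.exists_forall_mem (hM : IsMonster L M) {C : Set M} (hC : #C < #M)
    {γ : Type*} [Finite γ] {ι : Type*} [Nonempty ι] (S : ι → Set (γ → M))
    (hS : ∀ i, C.Definable L (S i)) (hdir : ∀ i j, ∃ k, S k ⊆ S i ∧ S k ⊆ S j)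
    (hne : ∀ i, (S i).Nonempty) : ∃ x, ∀ i, x ∈ S i := by
  classical
  obtain ⟨k, ⟨e⟩⟩ := Finite.exists_equiv_fin γ
  choose φ hφ using hS
  obtain ⟨a, ha⟩ := hM.saturated k C hC (Set.range fun i => (φ i).relabel e) (by
    intro Γ₀ hΓ₀
    have key : ∃ k, ∀ ψ ∈ Γ₀, ∀ x : γ → M, x ∈ S k → ψ.Realize (x ∘ e.symm) := by
      induction Γ₀ using Finset.induction with
      | empty => exact ⟨Classical.arbitrary ι, by simp⟩
      | insert ψ Γ₁ _ ih =>
        rw [Finset.coe_insert, Set.insert_subset_iff] at hΓ₀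
        obtain ⟨k, hk⟩ := ih hΓ₀.2
        obtain ⟨i, rfl⟩ := hΓ₀.1
        obtain ⟨l, hl, hl'⟩ := hdir k i
        refine ⟨l, fun ψ hψ x hx => ?_⟩
        rcases Finset.mem_insert.1 hψ with rfl | hψ
        · have := hl' hx
          rw [hφ] at this
          simpa [Formula.realize_relabel, Function.comp_assoc] using this
        · exact hk ψ hψ x (hl hx)
    obtain ⟨k, hk⟩ := key
    obtain ⟨x, hx⟩ := hne k
    exact ⟨x ∘ e.symm, fun ψ hψ => hk ψ hψ x hx⟩)
  refine ⟨a ∘ e, fun i => ?_⟩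
  rw [hφ]
  exact Formula.realize_relabel.1 (ha _ ⟨i, rfl⟩)

theorem IsMonster.card_union_range_lt (hM : IsMonster L M) {A : Set M} (hA : #A < #M)
    {β : Type*} [Finite β] (c : β → M) : #↥(A ∪ Set.range c) < #M :=
  (Cardinal.mk_union_le _ _).trans_lt (Cardinal.add_lt_of_lt hM.uncountable.le hA
    ((Cardinal.lt_aleph0_of_finite _).trans hM.uncountable))

/-- Saturation over a small set `A` together with a finite tuple of further parameters. -/
theorem IsMonster.exists_forall_elim_mem (hM : IsMonster L M) {A : Set M} (hA : #A < #M)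
    {γ β : Type*} [Finite γ] [Finite β] (c : β → M) {ι : Type*} [Nonempty ι]
    (S : ι → Set (γ ⊕ β → M)) (hS : ∀ i, A.Definable L (S i))
    (hdir : ∀ i j, ∃ k, S k ⊆ S i ∧ S k ⊆ S j)
    (hne : ∀ i, ∃ x, Sum.elim x c ∈ S i) : ∃ x, ∀ i, Sum.elim x c ∈ S i :=
  hM.exists_forall_mem (hM.card_union_range_lt hA c) (fun i => {x | Sum.elim x c ∈ S i})
    (fun i => (definable_union_range_iff c).2 ⟨S i, hS i, rfl⟩)
    (fun i j => (hdir i j).imp fun _ hk => ⟨fun _ hx => hk.1 hx, fun _ hx => hk.2 hx⟩) hne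

/-- Every type over `A` in more variables that is realized over `c'` can be realized over any `c`
of the same type. -/
theorem IsMonster.exists_typeEq_elim (hM : IsMonster L M) {A : Set M} (hA : #A < #M)
    {γ β : Type*} [Finite γ] [Finite β] {c c' : β → M} (h : TypeEq L A c c') (b : γ → M) :
    ∃ b' : γ → M, TypeEq L A (Sum.elim b c) (Sum.elim b' c') := by
  have : Nonempty {S : Set (γ ⊕ β → M) // A.Definable L S ∧ Sum.elim b c ∈ S} :=
    ⟨⟨Set.univ, Set.definable_univ, trivial⟩⟩
  obtain ⟨b', hb'⟩ := hM.exists_forall_elim_mem hA c'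
    (ι := {S : Set (γ ⊕ β → M) // A.Definable L S ∧ Sum.elim b c ∈ S})
    (fun S => S.1) (fun S => S.2.1)
    (fun S T => ⟨⟨S.1 ∩ T.1, S.2.1.inter T.2.1, S.2.2, T.2.2⟩,
      Set.inter_subset_left, Set.inter_subset_right⟩)
    (fun S => (h _ (definable_exists_left S.2.1)).1 ⟨b, S.2.2⟩)
  exact ⟨b', typeEq_of_imp fun S hS hb => hb' ⟨S, hS, hb⟩⟩

end Saturation

/-! ### The locus of a complete type -/

section Locus

variable {L : FirstOrder.Language.{u, v}} {M : Type w} [L.Structure M] {A : Set M} {n : ℕ}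
  {p : TypeOver L A n}

open FirstOrder.Language

theorem realize_iff_mem_of_mem_locus {a : Fin n → M} (ha : a ∈ locus p)
    (φ : L[[A]].Formula (Fin n)) : φ.Realize a ↔ Formula.equivSentence φ ∈ p := by
  refine ⟨fun h => ?_, fun h => ha φ h⟩
  by_contra hn
  have := ha φ.not ((p.not_mem_iff _).2 hn)
  exact Formula.realize_not.1 this h

theorem typeEq_of_mem_locus {a b : Fin n → M} (ha : a ∈ locus p) (hb : b ∈ locus p) :
    TypeEq L A a b := by
  rintro _ ⟨φ, rfl⟩
  exact (realize_iff_mem_of_mem_locus ha φ).trans (realize_iff_mem_of_mem_locus hb φ).symm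

theorem mem_locus_of_forall {a : Fin n → M}
    (h : ∀ S : Set (Fin n → M), A.Definable L S → locus p ⊆ S → a ∈ S) : a ∈ locus p :=
  fun φ hφ => h {x | φ.Realize x} ⟨φ, rfl⟩ fun _ hx => hx φ hφ

theorem mem_locus_of_typeEq {a b : Fin n → M} (ha : a ∈ locus p) (h : TypeEq L A a b) :
    b ∈ locus p :=
  mem_locus_of_forall fun S hS hp => (h S hS).1 (hp ha)

end Locus

/-! ### Saturation and compactness inside a locus -/

section LocusSaturation

variable {L : FirstOrder.Language.{u, v}} {M : Type w} [L.Structure M] {A : Set M} {n : ℕ}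
  {p : TypeOver L A n} {β : Type*} [Finite β]

/-- Saturation inside the locus of `p`: it suffices to find points in every `A`-definable set
containing the locus. -/
theorem IsMonster.exists_mem_locus_forall (hM : IsMonster L M) (hA : #A < #M) (c : β → M)
    {ι : Type*} [Nonempty ι] (S : ι → Set (Fin n ⊕ β → M)) (hS : ∀ i, A.Definable L (S i))
    (hdir : ∀ i j, ∃ k, S k ⊆ S i ∧ S k ⊆ S j)
    (hne : ∀ i, ∀ Θ : Set (Fin n → M), A.Definable L Θ → locus p ⊆ Θ →
      ∃ x ∈ Θ, Sum.elim x c ∈ S i) :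
    ∃ x ∈ locus p, ∀ i, Sum.elim x c ∈ S i := by
  let J := {Θ : Set (Fin n → M) // A.Definable L Θ ∧ locus p ⊆ Θ}
  have : Nonempty J := ⟨⟨Set.univ, Set.definable_univ, Set.subset_univ _⟩⟩
  obtain ⟨x, hx⟩ := hM.exists_forall_elim_mem hA c (ι := ι × J)
    (fun i => {w | w ∘ Sum.inl ∈ i.2.1} ∩ S i.1)
    (fun i => (i.2.2.1.preimage_comp Sum.inl).inter (hS i.1))
    (fun i j => by
      obtain ⟨k, hk, hk'⟩ := hdir i.1 j.1
      exact ⟨⟨k, i.2.1 ∩ j.2.1, i.2.2.1.inter j.2.2.1, Set.subset_inter i.2.2.2 j.2.2.2⟩,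
        fun w hw => ⟨hw.1.1, hk hw.2⟩, fun w hw => ⟨hw.1.2, hk' hw.2⟩⟩)
    (fun i => by
      obtain ⟨x, hx, hxS⟩ := hne i.1 i.2.1 i.2.2.1 i.2.2.2
      exact ⟨x, hx, hxS⟩)
  exact ⟨x, mem_locus_of_forall fun Θ hΘ hp => (hx (Classical.arbitrary ι, ⟨Θ, hΘ, hp⟩)).1,
    fun i => (hx (i, Classical.arbitrary J)).2⟩

theorem IsMonster.exists_mem_locus (hM : IsMonster L M) (hA : #A < #M) (c : β → M)
    {S : Set (Fin n ⊕ β → M)} (hS : A.Definable L S)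
    (hne : ∀ Θ : Set (Fin n → M), A.Definable L Θ → locus p ⊆ Θ → ∃ x ∈ Θ, Sum.elim x c ∈ S) :
    ∃ x ∈ locus p, Sum.elim x c ∈ S := by
  obtain ⟨x, hx, h⟩ := hM.exists_mem_locus_forall hA c (fun _ : Unit => S) (fun _ => hS)
    (fun _ _ => ⟨(), subset_rfl, subset_rfl⟩) (fun _ => hne)
  exact ⟨x, hx, h ()⟩

/-- Compactness: a condition that holds throughout the locus of `p` holds on some `A`-definable
set containing the locus. -/
theorem IsMonster.exists_definable_superset (hM : IsMonster L M) (hA : #A < #M) (c : β → M)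
    {S : Set (Fin n ⊕ β → M)} (hS : A.Definable L S) (h : ∀ x ∈ locus p, Sum.elim x c ∈ S) :
    ∃ Θ : Set (Fin n → M), A.Definable L Θ ∧ locus p ⊆ Θ ∧ ∀ x ∈ Θ, Sum.elim x c ∈ S := by
  by_contra! hcon
  obtain ⟨x, hx, hxS⟩ := hM.exists_mem_locus (p := p) hA c hS.compl hcon
  exact hxS (h x hx)

theorem IsMonster.exists_mem_locus_of_typeEq (hM : IsMonster L M) (hA : #A < #M) {c c' : β → M}
    (hc : TypeEq L A c c') {S : Set (Fin n ⊕ β → M)} (hS : A.Definable L S)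
    (h : ∃ x ∈ locus p, Sum.elim x c ∈ S) : ∃ x ∈ locus p, Sum.elim x c' ∈ S := by
  obtain ⟨x, hx, hxS⟩ := h
  obtain ⟨x', hx'⟩ := hM.exists_typeEq_elim hA hc x
  exact ⟨x', mem_locus_of_typeEq hx (hx'.comp Sum.inl), (hx' S hS).1 hxS⟩

end LocusSaturation

/-! ### Right-eventual sets -/

section Eventual

variable {X : Type*} {lt : X → X → Prop}

theorem RightEventual.mono {D E : Set X} (h : RightEventual lt D) (hDE : D ⊆ E) :
    RightEventual lt E :=
  let ⟨I, hI, hne, hfin⟩ := h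
  ⟨I, hI.trans hDE, hne, hfin⟩

theorem RightEventual.nonempty {D : Set X} (h : RightEventual lt D) : D.Nonempty :=
  let ⟨_, hI, hne, _⟩ := h
  hne.mono hI

theorem RightEventual.inter [IsStrictTotalOrder X lt] {D E : Set X} (hD : RightEventual lt D)
    (hE : RightEventual lt E) : RightEventual lt (D ∩ E) := by
  obtain ⟨I, hI, ⟨x, hx⟩, hfin⟩ := hD
  obtain ⟨J, hJ, ⟨y, hy⟩, hfin'⟩ := hE
  refine ⟨I ∩ J, Set.inter_subset_inter hI hJ, ?_,
    fun a ha b hb => ⟨hfin a ha.1 b hb, hfin' a ha.2 b hb⟩⟩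
  rcases trichotomous_of lt x y with hxy | rfl | hxy
  · exact ⟨y, hfin x hx y hxy, hy⟩
  · exact ⟨x, hx, hy⟩
  · exact ⟨x, hx, hfin' y hy x hxy⟩

end Eventual

/-! ### Definable families over an so-pair -/

section SoPair

variable {L : FirstOrder.Language.{u, v}} {M : Type w} [L.Structure M] {A : Set M} {n : ℕ}
  {p : TypeOver L A n} {lt : locus p → locus p → Prop} {β : Type*}

/-- A non-algebraic so-pair over a small set of parameters in a monster model. -/
structure IsLargeSoPair (p : TypeOver L A n) (lt : locus p → locus p → Prop) : Prop
    extends IsSoPair p lt where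
  monster : IsMonster L M
  small : #A < #M
  nonAlgebraic : NonAlgebraic p

/-- The trace on the locus of `p` of the fibre of `S` at `c`. -/
def fiber (p : TypeOver L A n) (S : Set (Fin n ⊕ β → M)) (c : β → M) : Set (locus p) :=
  {x | Sum.elim (x : Fin n → M) c ∈ S}

/-- The converse of a binary relation between tuples. -/
def converse (S : Set (Fin n ⊕ Fin n → M)) : Set (Fin n ⊕ Fin n → M) :=
  {w | w ∘ Sum.swap ∈ S}

theorem elim_mem_converse {S : Set (Fin n ⊕ Fin n → M)} {x y : Fin n → M} :
    Sum.elim x y ∈ converse S ↔ Sum.elim y x ∈ S := by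
  refine iff_of_eq (congrArg (· ∈ S) ?_)
  funext z
  rcases z with z | z <;> rfl

theorem definable_converse {S : Set (Fin n ⊕ Fin n → M)} (hS : A.Definable L S) :
    A.Definable L (converse S) :=
  hS.preimage_comp Sum.swap

theorem elim_comp_inr_comp {α β γ δ : Type*} (x : α → δ) (c : β → δ) (f : γ → β) :
    Sum.elim x c ∘ (Sum.inr ∘ f) = c ∘ f := rfl

theorem relDefinable_fiber [Finite β] {S : Set (Fin n ⊕ β → M)} (hS : A.Definable L S)
    (c : β → M) : RelDefinable L Set.univ (fiber p S c) :=
  ⟨_, ((definable_union_range_iff c).2 ⟨S, hS, rfl⟩).mono (Set.subset_univ _), rfl⟩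

namespace IsLargeSoPair

/-- Reversing the order turns a non-algebraic so-pair into another one. -/
theorem reverse (h : IsLargeSoPair p lt) : IsLargeSoPair p (fun a b => lt b a) where
  linear := have := h.linear; inferInstanceAs (IsStrictTotalOrder _ (Function.swap lt))
  definable := by
    obtain ⟨D, hD, hlt⟩ := h.definable
    exact ⟨converse D, definable_converse hD,
      fun a b => (hlt b a).trans elim_mem_converse.symm⟩
  left := h.right
  right := h.left
  monster := h.monster
  small := h.small
  nonAlgebraic := h.nonAlgebraic

theorem irrefl (h : IsLargeSoPair p lt) (a : locus p) : ¬ lt a a :=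
  have := h.linear; irrefl_of lt a

theorem trans (h : IsLargeSoPair p lt) {a b c : locus p} (hab : lt a b) (hbc : lt b c) :
    lt a c :=
  have := h.linear; trans_of lt hab hbc

theorem trichotomy (h : IsLargeSoPair p lt) (a b : locus p) : lt a b ∨ a = b ∨ lt b a :=
  have := h.linear; trichotomous_of lt a b

theorem asymm (h : IsLargeSoPair p lt) {a b : locus p} (hab : lt a b) : ¬ lt b a :=
  fun hba => h.irrefl a (h.trans hab hba)

/-- All points of the locus have the same type over `A`, so if one is not maximal, none is. -/
theorem exists_gt (h : IsLargeSoPair p lt) (a : locus p) : ∃ b, lt a b := by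
  obtain ⟨D, hD, hlt⟩ := h.definable
  obtain ⟨x, hx, y, hy, hxy⟩ := (show (locus p).Infinite from h.nonAlgebraic).nontrivial
  have key : ∃ x y : locus p, lt x y := by
    rcases h.trichotomy ⟨x, hx⟩ ⟨y, hy⟩ with hl | he | hl
    · exact ⟨_, _, hl⟩
    · exact absurd (congrArg Subtype.val he) hxy
    · exact ⟨_, _, hl⟩
  obtain ⟨x, y, hl⟩ := key
  obtain ⟨b, hb, hab⟩ := h.monster.exists_mem_locus_of_typeEq (p := p) h.small
    (typeEq_of_mem_locus x.2 a.2) (definable_converse hD)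
    ⟨y, y.2, elim_mem_converse.2 ((hlt _ _).1 hl)⟩
  exact ⟨⟨b, hb⟩, (hlt _ _).2 (elim_mem_converse.1 hab)⟩

theorem rightEventual_or (h : IsLargeSoPair p lt) [Finite β] {S : Set (Fin n ⊕ β → M)}
    (hS : A.Definable L S) (c : β → M) :
    RightEventual lt (fiber p S c) ∨ RightEventual lt (fiber p Sᶜ c) :=
  (h.right _ (relDefinable_fiber hS c)).or

/-- The order on the locus is given by an `A`-definable relation that is irreflexive and transitive
on a whole `A`-definable set containing the locus. -/
theorem exists_definable_order (h : IsLargeSoPair p lt) :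
    ∃ (D : Set (Fin n ⊕ Fin n → M)) (Θ : Set (Fin n → M)), A.Definable L D ∧ A.Definable L Θ ∧
      locus p ⊆ Θ ∧ (∀ a b : locus p, lt a b ↔ Sum.elim (a : Fin n → M) (b : Fin n → M) ∈ D) ∧
      (∀ x ∈ Θ, Sum.elim x x ∉ D) ∧
      ∀ x ∈ Θ, ∀ y ∈ Θ, ∀ z ∈ Θ, Sum.elim x y ∈ D → Sum.elim y z ∈ D → Sum.elim x z ∈ D := by
  obtain ⟨D, hD, hlt⟩ := h.definable
  suffices ∃ Θ : Set (Fin n → M), A.Definable L Θ ∧ locus p ⊆ Θ ∧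
      ∀ x ∈ Θ, ∀ y ∈ Θ, ∀ z ∈ Θ, ¬ (Sum.elim x x ∈ D ∨
        (Sum.elim x y ∈ D ∧ Sum.elim y z ∈ D) ∧ Sum.elim x z ∉ D) by
    obtain ⟨Θ, hΘ, hp, H⟩ := this
    refine ⟨D, Θ, hD, hΘ, hp, hlt, fun x hx hD => H x hx x hx x hx (Or.inl hD),
      fun x hx y hy z hz hxy hyz => by_contra fun hxz => H x hx y hy z hz (Or.inr ⟨⟨hxy, hyz⟩, hxz⟩)⟩
  by_contra! hcon
  let J := {Θ : Set (Fin n → M) // A.Definable L Θ ∧ locus p ⊆ Θ}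
  have : Nonempty J := ⟨⟨Set.univ, Set.definable_univ, Set.subset_univ _⟩⟩
  -- the three coordinates of a point of `Fin n ⊕ Fin n ⊕ Fin n → M`
  let i₁ : Fin n → Fin n ⊕ Fin n ⊕ Fin n := Sum.inl
  let i₂ : Fin n → Fin n ⊕ Fin n ⊕ Fin n := Sum.inr ∘ Sum.inl
  let i₃ : Fin n → Fin n ⊕ Fin n ⊕ Fin n := Sum.inr ∘ Sum.inr
  let B : Set (Fin n ⊕ Fin n ⊕ Fin n → M) :=
    {w | w ∘ Sum.elim i₁ i₁ ∈ D} ∪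
      (({w | w ∘ Sum.elim i₁ i₂ ∈ D} ∩ {w | w ∘ Sum.elim i₂ i₃ ∈ D}) ∩
        {w | w ∘ Sum.elim i₁ i₃ ∈ D}ᶜ)
  have hB : A.Definable L B := (hD.preimage_comp _).union
    (((hD.preimage_comp _).inter (hD.preimage_comp _)).inter (hD.preimage_comp _).compl)
  have hBmem : ∀ w, w ∈ B ↔ (Sum.elim (w ∘ i₁) (w ∘ i₁) ∈ D ∨
      (Sum.elim (w ∘ i₁) (w ∘ i₂) ∈ D ∧ Sum.elim (w ∘ i₂) (w ∘ i₃) ∈ D) ∧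
        Sum.elim (w ∘ i₁) (w ∘ i₃) ∉ D) := fun w => by
    simp only [← Sum.comp_elim]
    rfl
  obtain ⟨w, hw⟩ := h.monster.exists_forall_mem h.small
    (fun Θ : J => ({w | w ∘ i₁ ∈ Θ.1} ∩ {w | w ∘ i₂ ∈ Θ.1} ∩ {w | w ∘ i₃ ∈ Θ.1}) ∩ B)
    (fun Θ => (((Θ.2.1.preimage_comp _).inter (Θ.2.1.preimage_comp _)).inter
      (Θ.2.1.preimage_comp _)).inter hB)
    (fun Θ Θ' => ⟨⟨Θ.1 ∩ Θ'.1, Θ.2.1.inter Θ'.2.1, Set.subset_inter Θ.2.2 Θ'.2.2⟩,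
      fun w hw => ⟨⟨⟨hw.1.1.1.1, hw.1.1.2.1⟩, hw.1.2.1⟩, hw.2⟩,
      fun w hw => ⟨⟨⟨hw.1.1.1.2, hw.1.1.2.2⟩, hw.1.2.2⟩, hw.2⟩⟩)
    (fun Θ => by
      obtain ⟨x, hx, y, hy, z, hz, hbad⟩ := hcon Θ.1 Θ.2.1 Θ.2.2
      exact ⟨Sum.elim x (Sum.elim y z), ⟨⟨hx, hy⟩, hz⟩, (hBmem _).2 hbad⟩)
  have hx : w ∘ i₁ ∈ locus p := mem_locus_of_forall fun Θ hΘ hp => (hw ⟨Θ, hΘ, hp⟩).1.1.1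
  have hy : w ∘ i₂ ∈ locus p := mem_locus_of_forall fun Θ hΘ hp => (hw ⟨Θ, hΘ, hp⟩).1.1.2
  have hz : w ∘ i₃ ∈ locus p := mem_locus_of_forall fun Θ hΘ hp => (hw ⟨Θ, hΘ, hp⟩).1.2
  rcases (hBmem w).1 (hw (Classical.arbitrary J)).2 with hbad | ⟨⟨hxy, hyz⟩, hxz⟩
  · exact h.irrefl ⟨_, hx⟩ ((hlt _ _).2 hbad)
  · exact hxz ((hlt ⟨_, hx⟩ ⟨_, hz⟩).1
      (h.trans ((hlt _ ⟨_, hy⟩).2 hxy) ((hlt ⟨_, hy⟩ _).2 hyz)))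

/-- A definable family containing a right-eventual member can be shrunk, uniformly in the
parameters, to a definable family of final parts of the locus, keeping that member non-empty. -/
theorem exists_final_subfamily (h : IsLargeSoPair p lt) [Finite β] {S : Set (Fin n ⊕ β → M)}
    (hS : A.Definable L S) {c : β → M} (hc : RightEventual lt (fiber p S c)) :
    ∃ T, A.Definable L T ∧ T ⊆ S ∧ (∀ c', IsFinalPart lt (fiber p T c')) ∧
      (fiber p T c).Nonempty := by
  obtain ⟨D, Θ₀, hD, hΘ₀, hpΘ₀, hlt, -, htrans⟩ := h.exists_definable_order
  obtain ⟨I, hI, ⟨e, he⟩, hfin⟩ := hc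
  obtain ⟨Θ₁, hΘ₁, hpΘ₁, hΘ₁S⟩ := h.monster.exists_definable_superset (p := p) h.small
    (Sum.elim (e : Fin n → M) c)
    (S := {w | w ∘ Sum.elim (Sum.inr ∘ Sum.inl) Sum.inl ∈ D}ᶜ ∪
      {w | w ∘ Sum.elim Sum.inl (Sum.inr ∘ Sum.inr) ∈ S})
    ((hD.preimage_comp _).compl.union (hS.preimage_comp _)) (fun x hx => by
      by_cases hxe : lt e ⟨x, hx⟩
      · exact Or.inr (by simpa [Sum.comp_elim, elim_comp_inr_comp, fiber] using hI (hfin e he _ hxe))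
      · refine Or.inl fun hxD => hxe ((hlt _ _).2 ?_)
        simpa [Sum.comp_elim, elim_comp_inr_comp] using hxD)
  replace hΘ₁S : ∀ x ∈ Θ₁, Sum.elim (e : Fin n → M) x ∈ D → Sum.elim x c ∈ S := fun x hx hxD => by
    rcases hΘ₁S x hx with hn | hxS
    · exact absurd (by simpa [Sum.comp_elim, elim_comp_inr_comp] using hxD) hn
    · simpa [Sum.comp_elim, elim_comp_inr_comp] using hxS
  let B : Set (Fin n ⊕ (Fin n ⊕ β) → M) :=
    {w | w ∘ Sum.inl ∈ Θ₀ ∩ Θ₁} ∩ ({w | w ∘ Sum.elim (Sum.inr ∘ Sum.inl) Sum.inl ∈ D} ∩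
      {w | w ∘ Sum.elim Sum.inl (Sum.inr ∘ Sum.inr) ∈ S}ᶜ)
  have hB : A.Definable L B := ((hΘ₀.inter hΘ₁).preimage_comp _).inter
    ((hD.preimage_comp _).inter (hS.preimage_comp _).compl)
  let T : Set (Fin n ⊕ β → M) := S ∩ {w | ∃ x : Fin n → M, Sum.elim x w ∈ B}ᶜ
  have hT : ∀ y c', Sum.elim y c' ∈ T ↔ Sum.elim y c' ∈ S ∧
      ∀ x ∈ Θ₀ ∩ Θ₁, Sum.elim y x ∈ D → Sum.elim x c' ∈ S := fun y c' => by
    simp [T, B, Sum.comp_elim, elim_comp_inr_comp]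
  refine ⟨T, hS.inter (definable_exists_left hB).compl, Set.inter_subset_left, ?_, e, ?_⟩
  · intro c' a ha b hab
    have ha := (hT a c').1 ha
    have hab' := (hlt a b).1 hab
    exact (hT b c').2 ⟨ha.2 b ⟨hpΘ₀ b.2, hpΘ₁ b.2⟩ hab', fun x hx hbx =>
      ha.2 x hx (htrans _ (hpΘ₀ a.2) _ (hpΘ₀ b.2) _ hx.1 hab' hbx)⟩
  · exact (hT e c).2 ⟨hI he, fun x hx => hΘ₁S x hx.2⟩

/-- The right globalization is `A`-invariant. -/
theorem rightEventual_of_typeEq (h : IsLargeSoPair p lt) [Finite β] {S : Set (Fin n ⊕ β → M)}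
    (hS : A.Definable L S) {c c' : β → M} (hcc' : TypeEq L A c c')
    (hc : RightEventual lt (fiber p S c)) : RightEventual lt (fiber p S c') := by
  obtain ⟨T, hT, hTS, hfin, e, he⟩ := h.exists_final_subfamily hS hc
  obtain ⟨e', he', heT⟩ := h.monster.exists_mem_locus_of_typeEq h.small hcc' hT ⟨e, e.2, he⟩
  exact ⟨fiber p T c', fun x hx => hTS hx, ⟨⟨e', he'⟩, heT⟩, hfin c'⟩

/-- If the fibres of `T` are non-empty final parts and the fibre at `a` lies above `a`, then every
point `c` belongs to the fibres at all sufficiently small points. -/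
theorem leftEventual_converse (h : IsLargeSoPair p lt) {T : Set (Fin n ⊕ Fin n → M)}
    (hT : A.Definable L T) (hfin : ∀ a : locus p, IsFinalPart lt (fiber p T a)) {a : locus p}
    (hne : (fiber p T a).Nonempty) (hlt : ∀ a x : locus p, x ∈ fiber p T a → lt a x)
    (c : locus p) : LeftEventual lt (fiber p (converse T) c) := by
  have hex : ∀ x : locus p, ∃ a : locus p, x ∈ fiber p T a := fun x => by
    obtain ⟨y, hy⟩ := hne
    obtain ⟨b, hb, hbx⟩ := h.monster.exists_mem_locus_of_typeEq (p := p) h.small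
      (typeEq_of_mem_locus y.2 x.2) (definable_converse hT) ⟨a, a.2, elim_mem_converse.2 hy⟩
    exact ⟨⟨b, hb⟩, elim_mem_converse.1 hbx⟩
  refine (h.reverse.rightEventual_or (definable_converse hT) c).resolve_right ?_
  rintro ⟨I, hI, ⟨d, hd⟩, hini⟩
  -- a point `x ≤ c` with `x ≤ d` belongs to some fibre at a point of `I`
  have key : ∀ x : locus p, (x = d ∨ lt x d) → (x = c ∨ lt x c) → False := fun x hxd hxc => by
    obtain ⟨b, hb⟩ := hex x
    have hbd : lt b d := by
      rcases hxd with rfl | hxd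
      · exact hlt _ _ hb
      · exact h.trans (hlt _ _ hb) hxd
    have hbc : c ∈ fiber p T b := by
      rcases hxc with rfl | hxc
      · exact hb
      · exact hfin b _ hb _ hxc
    exact hI (hini d hd b hbd) (elim_mem_converse.2 hbc)
  rcases h.trichotomy c d with hcd | rfl | hcd
  · exact key c (Or.inr hcd) (Or.inl rfl)
  · exact key c (Or.inl rfl) (Or.inl rfl)
  · exact key d (Or.inl rfl) (Or.inr hcd)

/-- A definable binary relation `S x a` that holds for all large `x` contains one, written with its
arguments exchanged, that still holds for all large `x` and is preserved when `a` decreases. -/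
theorem exists_decreasing_subrelation (h : IsLargeSoPair p lt) {S : Set (Fin n ⊕ Fin n → M)}
    (hS : A.Definable L S) {a : locus p} (ha : RightEventual lt (fiber p S a)) :
    ∃ T, A.Definable L T ∧ T ⊆ converse S ∧ (∀ x : locus p, IsInitialPart lt (fiber p T x)) ∧
      ∀ b : locus p, RightEventual lt (fiber p (converse T) b) := by
  obtain ⟨D, hD, hlt⟩ := h.definable
  have hgt : RightEventual lt (fiber p (converse D) a) :=
    ⟨{x | lt a x}, fun x hx => elim_mem_converse.2 ((hlt _ _).1 hx), h.exists_gt a,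
      fun x hx y hxy => h.trans hx hxy⟩
  have := h.linear
  obtain ⟨U, hU, hUS, hUfin, hUne⟩ :=
    h.exists_final_subfamily (hS.inter (definable_converse hD)) (ha.inter hgt)
  have hUlt : ∀ a x : locus p, x ∈ fiber p U a → lt a x := fun a x hx =>
    (hlt _ _).2 (elim_mem_converse.1 (hUS hx).2)
  obtain ⟨T, hT, hTU, hTini, hTne⟩ := h.reverse.exists_final_subfamily (definable_converse hU)
    (c := a) (h.leftEventual_converse hU (fun a => hUfin a) hUne hUlt a)
  refine ⟨T, hT, fun w hw => (hUS (hTU hw)).1, fun x => hTini x,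
    h.reverse.leftEventual_converse hT (fun x => hTini x) hTne fun x y hy => ?_⟩
  exact hUlt _ _ (elim_mem_converse.1 (hTU hy))

end IsLargeSoPair

end SoPair

/-! ### The genericity order -/

section Genericity

variable {L : FirstOrder.Language.{u, v}} {M : Type w} [L.Structure M] {A : Set M} {n : ℕ}
  {p : TypeOver L A n} {lt : locus p → locus p → Prop} {β : Type*}

open FirstOrder.Language

/-- Genericity over a tuple in terms of fibres of `A`-definable sets. -/
theorem rightGeneric_range_iff {c : β → M} {b : locus p} :
    RightGeneric p lt (Set.range c) b ↔ ∀ S : Set (Fin n ⊕ β → M), A.Definable L S →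
      RightEventual lt (fiber p S c) → b ∈ fiber p S c := by
  have hmem : ∀ φ : L[[↥(A ∪ Set.range c)]].Formula (Fin n),
      φ ∈ restrictParams (rightGlobalization p lt) (A ∪ Set.range c) ↔
        RightEventual lt {a : locus p | φ.Realize (a : Fin n → M)} := fun φ => by
    simp [restrictParams, rightGlobalization]
  constructor
  · intro hb S hS hev
    obtain ⟨φ, hφ⟩ := (definable_union_range_iff c).2 ⟨S, hS, rfl⟩
    have hfib : fiber p S c = {a : locus p | φ.Realize (a : Fin n → M)} :=
      Set.ext fun a => Set.ext_iff.1 hφ a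
    rw [hfib] at hev ⊢
    exact hb φ ((hmem φ).2 hev)
  · intro hb φ hφ
    obtain ⟨S, hS, hφS⟩ := (definable_union_range_iff (L := L) (A := A) c).1 ⟨φ, rfl⟩
    have hfib : fiber p S c = {a : locus p | φ.Realize (a : Fin n → M)} :=
      Set.ext fun a => (Set.ext_iff.1 hφS a).symm
    have := hb S hS (hfib ▸ (hmem φ).1 hφ)
    rwa [hfib] at this

theorem triangle_iff {a b : locus p} :
    Triangle p lt a b ↔ ∀ S : Set (Fin n ⊕ Fin n → M), A.Definable L S →
      RightEventual lt (fiber p S a) → b ∈ fiber p S a :=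
  rightGeneric_range_iff

/-- Composing two definable relations that hold for all large values of their first argument gives
another such relation. The intermediate point is only required to lie in `Θ`, so that the composite
is definable. -/
theorem Triangle.exists_comp {a c : locus p} (hac : Triangle p lt a c)
    {S T : Set (Fin n ⊕ Fin n → M)} (hS : A.Definable L S) (hT : A.Definable L T)
    (hSev : RightEventual lt (fiber p S a)) (hTev : ∀ b : locus p, RightEventual lt (fiber p T b))
    {Θ : Set (Fin n → M)} (hΘ : A.Definable L Θ) (hp : locus p ⊆ Θ) :
    ∃ y ∈ Θ, Sum.elim y (a : Fin n → M) ∈ S ∧ Sum.elim (c : Fin n → M) y ∈ T := by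
  let B : Set (Fin n ⊕ (Fin n ⊕ Fin n) → M) :=
    {w | w ∘ Sum.inl ∈ Θ} ∩ ({w | w ∘ Sum.elim Sum.inl (Sum.inr ∘ Sum.inr) ∈ S} ∩
      {w | w ∘ Sum.elim (Sum.inr ∘ Sum.inl) Sum.inl ∈ T})
  have hB : A.Definable L B := (hΘ.preimage_comp _).inter
    ((hS.preimage_comp _).inter (hT.preimage_comp _))
  have hBmem : ∀ y x z : Fin n → M, Sum.elim y (Sum.elim x z) ∈ B ↔
      y ∈ Θ ∧ Sum.elim y z ∈ S ∧ Sum.elim x y ∈ T := fun y x z => by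
    simp [B, Sum.comp_elim, elim_comp_inr_comp]
  obtain ⟨y, hy⟩ := hSev.nonempty
  obtain ⟨x, hx⟩ := triangle_iff.1 hac _ (definable_exists_left hB)
    ((hTev y).mono fun x hx => ⟨y, (hBmem _ _ _).2 ⟨hp y.2, hy, hx⟩⟩)
  exact ⟨x, (hBmem _ _ _).1 hx⟩

namespace IsLargeSoPair

theorem exists_rightGeneric (h : IsLargeSoPair p lt) [Finite β] (c : β → M) :
    ∃ b, RightGeneric p lt (Set.range c) b := by
  have := h.linear
  let J := {S : Set (Fin n ⊕ β → M) // A.Definable L S ∧ RightEventual lt (fiber p S c)}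
  have huniv : RightEventual lt (fiber p (Set.univ : Set (Fin n ⊕ β → M)) c) := by
    obtain ⟨x, hx⟩ := (show (locus p).Infinite from h.nonAlgebraic).nonempty
    exact ⟨Set.univ, fun _ _ => trivial, ⟨⟨x, hx⟩, trivial⟩, fun _ _ _ _ => trivial⟩
  have : Nonempty J := ⟨⟨Set.univ, Set.definable_univ, huniv⟩⟩
  obtain ⟨b, hb, hbS⟩ := h.monster.exists_mem_locus_forall (p := p) h.small c (ι := J)
    (fun S => S.1) (fun S => S.2.1)
    (fun S T => ⟨⟨S.1 ∩ T.1, S.2.1.inter T.2.1, S.2.2.inter T.2.2⟩,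
      Set.inter_subset_left, Set.inter_subset_right⟩)
    (fun S Θ _ hΘ => by
      obtain ⟨x, hx⟩ := S.2.2.nonempty
      exact ⟨x, hΘ x.2, hx⟩)
  exact ⟨⟨b, hb⟩, rightGeneric_range_iff.2 fun S hS hev => hbS ⟨S, hS, hev⟩⟩

theorem lt_of_triangle (h : IsLargeSoPair p lt) {a b : locus p} (hab : Triangle p lt a b) :
    lt a b := by
  obtain ⟨D, hD, hlt⟩ := h.definable
  refine (hlt a b).2 (elim_mem_converse.1 (triangle_iff.1 hab _ (definable_converse hD) ?_))
  exact ⟨{x | lt a x}, fun x hx => elim_mem_converse.2 ((hlt _ _).1 hx), h.exists_gt a,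
    fun x hx y hxy => h.trans hx hxy⟩

theorem triangle_of_triangle_of_lt (h : IsLargeSoPair p lt) {a b c : locus p}
    (hab : Triangle p lt a b) (hbc : lt b c) : Triangle p lt a c := by
  refine triangle_iff.2 fun S hS hev => ?_
  obtain ⟨T, hT, hTS, hfin, hne⟩ := h.exists_final_subfamily hS hev
  exact hTS (hfin a b (triangle_iff.1 hab T hT ⟨_, subset_rfl, hne, hfin a⟩) c hbc)

theorem triangle_of_lt_of_triangle (h : IsLargeSoPair p lt) {a b c : locus p}
    (hab : lt a b) (hbc : Triangle p lt b c) : Triangle p lt a c := by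
  refine triangle_iff.2 fun S hS hev => ?_
  obtain ⟨T, hT, hTS, hini, hTev⟩ := h.exists_decreasing_subrelation hS hev
  have hb : b ∈ fiber p T c := elim_mem_converse.1
    (triangle_iff.1 hbc _ (definable_converse hT) (hTev b))
  exact elim_mem_converse.1 (hTS (hini c b hb a hab))

/-- Duality: if `b` is right generic over `a`, then `a` is left generic over `b`. -/
theorem triangle_reverse (h : IsLargeSoPair p lt) {a b : locus p} (hab : Triangle p lt a b) :
    Triangle p (fun a b => lt b a) b a := by
  refine triangle_iff.2 fun S hS hev => ?_
  obtain ⟨T, hT, hTS, hfin, hTev⟩ := h.reverse.exists_decreasing_subrelation hS hev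
  have hfib : RightEventual lt (fiber p T a) := by
    obtain ⟨x, hx⟩ := (hTev b).nonempty
    obtain ⟨y, hy⟩ := h.monster.exists_mem_locus_of_typeEq (p := p) h.small
      (typeEq_of_mem_locus x.2 a.2) hT ⟨b, b.2, elim_mem_converse.1 hx⟩
    exact ⟨_, subset_rfl, ⟨⟨y, hy.1⟩, hy.2⟩, hfin a⟩
  exact elim_mem_converse.1 (hTS (triangle_iff.1 hab T hT hfib))

/-- Genericity is negatively transitive, so that incomparability is an equivalence relation. -/
theorem triangle_or_triangle (h : IsLargeSoPair p lt) {a c : locus p} (hac : Triangle p lt a c)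
    (b : locus p) : Triangle p lt a b ∨ Triangle p lt b c := by
  by_contra! hcon
  simp only [triangle_iff, not_forall] at hcon
  obtain ⟨⟨S, hS, hSev, hSb⟩, ⟨S', hS', hS'ev, hS'c⟩⟩ := hcon
  obtain ⟨U, hU, hUS, hUfin, hUne⟩ := h.exists_final_subfamily hS hSev
  obtain ⟨T, hT, hTS', hTini, hTev⟩ := h.exists_decreasing_subrelation hS' hS'ev
  have hconv : ∀ {x y : Fin n → M}, Sum.elim x y ∈ converse T ↔ Sum.elim y x ∈ T :=
    elim_mem_converse
  -- a point `y` of the locus with `U y a` and `T y c`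
  obtain ⟨y, hy, hyUT⟩ := h.monster.exists_mem_locus (p := p) h.small
    (Sum.elim (a : Fin n → M) (c : Fin n → M))
    (S := {w | w ∘ Sum.elim Sum.inl (Sum.inr ∘ Sum.inl) ∈ U} ∩
      {w | w ∘ Sum.elim Sum.inl (Sum.inr ∘ Sum.inr) ∈ T})
    ((hU.preimage_comp _).inter (hT.preimage_comp _)) (fun Θ hΘ hp => by
      obtain ⟨y, hy, hyU, hyT⟩ := hac.exists_comp hU (definable_converse hT)
        ⟨_, subset_rfl, hUne, hUfin a⟩ hTev hΘ hp
      refine ⟨y, hy, ?_⟩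
      simpa [Sum.comp_elim, elim_comp_inr_comp] using ⟨hyU, hconv.1 hyT⟩)
  obtain ⟨hyU, hyT⟩ : Sum.elim y (a : Fin n → M) ∈ U ∧ Sum.elim y (c : Fin n → M) ∈ T := by
    simpa [Sum.comp_elim, elim_comp_inr_comp] using hyUT
  -- `b < y`, as `U` is final in its first argument, so `T b c`, as `T` is initial in its first one
  rcases h.trichotomy b ⟨y, hy⟩ with hby | rfl | hyb
  · exact hS'c (elim_mem_converse.1 (hTS' (hTini c ⟨y, hy⟩ hyT b hby)))
  · exact hSb (hUS hyU)
  · exact hSb (hUS (hUfin a ⟨y, hy⟩ hyU b hyb))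

/-- The genericity order is dense. -/
theorem exists_triangle_between (h : IsLargeSoPair p lt) {a b : locus p}
    (hab : Triangle p lt a b) : ∃ c, Triangle p lt a c ∧ Triangle p lt c b := by
  have := h.linear
  let J := {S : Set (Fin n ⊕ Fin n → M) // A.Definable L S ∧
    ∀ x : locus p, RightEventual lt (fiber p S x)}
  have hall : ∀ {S : Set (Fin n ⊕ Fin n → M)}, A.Definable L S → ∀ {x : locus p},
      RightEventual lt (fiber p S x) → ∀ y : locus p, RightEventual lt (fiber p S y) :=
    fun hS x hx y => h.rightEventual_of_typeEq hS (typeEq_of_mem_locus x.2 y.2) hx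
  have : Nonempty J := ⟨⟨Set.univ, Set.definable_univ, fun x =>
    ⟨Set.univ, fun _ _ => trivial, ⟨x, trivial⟩, fun _ _ _ _ => trivial⟩⟩⟩
  obtain ⟨c, hc, hcS⟩ := h.monster.exists_mem_locus_forall (p := p) h.small
    (Sum.elim (a : Fin n → M) (b : Fin n → M)) (ι := J)
    (fun S => {w | w ∘ Sum.elim Sum.inl (Sum.inr ∘ Sum.inl) ∈ S.1} ∩
      {w | w ∘ Sum.elim (Sum.inr ∘ Sum.inr) Sum.inl ∈ S.1})
    (fun S => (S.2.1.preimage_comp _).inter (S.2.1.preimage_comp _))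
    (fun S T => ⟨⟨S.1 ∩ T.1, S.2.1.inter T.2.1, fun x => (S.2.2 x).inter (T.2.2 x)⟩,
      fun w hw => ⟨hw.1.1, hw.2.1⟩, fun w hw => ⟨hw.1.2, hw.2.2⟩⟩)
    (fun S Θ hΘ hp => by
      obtain ⟨y, hy, hyS⟩ := hab.exists_comp S.2.1 S.2.1 (S.2.2 a) S.2.2 hΘ hp
      refine ⟨y, hy, ?_⟩
      simpa [Sum.comp_elim, elim_comp_inr_comp] using hyS)
  have key : ∀ S : J, Sum.elim c (a : Fin n → M) ∈ S.1 ∧ Sum.elim (b : Fin n → M) c ∈ S.1 :=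
    fun S => by simpa [Sum.comp_elim, elim_comp_inr_comp] using hcS S
  exact ⟨⟨c, hc⟩, triangle_iff.2 fun S hS hev => (key ⟨S, hS, hall hS hev⟩).1,
    triangle_iff.2 fun S hS hev => (key ⟨S, hS, hall hS hev⟩).2⟩

theorem triangle_of_reverse (h : IsLargeSoPair p lt) {a b : locus p}
    (hab : Triangle p (fun a b => lt b a) b a) : Triangle p lt a b :=
  h.reverse.triangle_reverse hab

end IsLargeSoPair

end Genericity

/-! ### Forking and incomparability -/

section Forking

variable {L : FirstOrder.Language.{u, v}} {M : Type w} [L.Structure M] {A : Set M} {n : ℕ}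
  {p : TypeOver L A n} {lt : locus p → locus p → Prop} {β : Type*}

open FirstOrder.Language

/-- Realizing `tp(a/Ac)` means having the same type as `a` together with `c`. -/
theorem forall_tp_realize_iff {c : β → M} {a x : Fin n → M} :
    (∀ ψ ∈ tp L (A ∪ Set.range c) a, ψ.Realize x) ↔
      TypeEq L A (Sum.elim a c) (Sum.elim x c) := by
  constructor
  · refine fun hx => typeEq_of_imp fun S hS ha => ?_
    obtain ⟨φ, hφ⟩ := (definable_union_range_iff c).2 ⟨S, hS, rfl⟩
    exact (Set.ext_iff.1 hφ x).2 (hx φ ((Set.ext_iff.1 hφ a).1 ha))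
  · intro hx ψ hψ
    obtain ⟨S, hS, hψS⟩ := (definable_union_range_iff (L := L) (A := A) c).1 ⟨ψ, rfl⟩
    exact (Set.ext_iff.1 hψS x).2 ((hx S hS).1 ((Set.ext_iff.1 hψS a).1 hψ))

/-- Adding parameters from `A` to two tuples of the same type over `A`. -/
theorem TypeEq.elim_right {γ : Type*} {b c : β → M} (h : TypeEq L A b c) {d : γ → M}
    (hd : ∀ i, d i ∈ A) : TypeEq L A (Sum.elim b d) (Sum.elim c d) := fun S hS => by
  have hS' : A.Definable L {x : β → M | Sum.elim x d ∈ S} := by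
    have := (definable_union_range_iff d).2 ⟨S, hS, rfl⟩
    rwa [Set.union_eq_left.2 (Set.range_subset_iff.2 hd)] at this
  exact h _ hS'

theorem triangle_of_typeEq {a x b : locus p} (hax : TypeEq L A
    (Sum.elim (a : Fin n → M) (b : Fin n → M)) (Sum.elim (x : Fin n → M) (b : Fin n → M)))
    (hx : Triangle p lt b x) : Triangle p lt b a :=
  triangle_iff.2 fun S hS hev => (hax S hS).2 (triangle_iff.1 hx S hS hev)

namespace IsLargeSoPair

/-- A dividing formula is not in the right globalization: the conjugates of a formula in an
`A`-invariant, finitely satisfiable global type are consistent. -/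
theorem not_rightEventual_of_divides (h : IsLargeSoPair p lt) {m : ℕ}
    {φ : L.Formula (Fin n ⊕ Fin m)} {b : Fin m → M} (hφ : Divides A φ b) :
    ¬ RightEventual lt (fiber p {w | φ.Realize w} b) := by
  intro hev
  obtain ⟨c, k, hc, hk⟩ := hφ
  have := h.linear
  have hdef : A.Definable L {w | φ.Realize w} :=
    (Set.empty_definable_iff.2 ⟨φ, rfl⟩).mono (Set.empty_subset A)
  have hall : ∀ s : Finset ℕ,
      RightEventual lt {x : locus p | ∀ i ∈ s, φ.Realize (Sum.elim (x : Fin n → M) (c i))} := by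
    intro s
    induction s using Finset.induction with
    | empty => exact hev.mono fun _ _ => by simp
    | insert i s _ ih =>
      refine ((h.rightEventual_of_typeEq hdef (sameType_iff_typeEq.1 (hc i)) hev).inter ih).mono ?_
      rintro x ⟨hx, hxs⟩ j hj
      rcases Finset.mem_insert.1 hj with rfl | hj
      · exact hx
      · exact hxs j hj
  obtain ⟨x, hx⟩ := (hall (Finset.range k)).nonempty
  exact hk _ (Finset.card_range k) ⟨x, hx⟩

theorem not_forkRel_of_triangle (h : IsLargeSoPair p lt) {a b : locus p}
    (hba : Triangle p lt b a) : ¬ ForkRel p a b := by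
  rintro ⟨N, m, φ, d, hdiv, himp⟩
  -- a generic point over `b` and all parameters of the forking formulas
  let e : (Σ j, Fin (m j)) → M := fun i => d i.1 i.2
  obtain ⟨x, hx⟩ := h.exists_rightGeneric (Sum.elim (b : Fin n → M) e)
  rw [rightGeneric_range_iff] at hx
  have hgen : ∀ {γ : Type} [Finite γ] (f : γ → Fin n ⊕ Σ j, Fin (m j))
      {S : Set (Fin n ⊕ γ → M)}, A.Definable L S →
      RightEventual lt (fiber p S (Sum.elim (b : Fin n → M) e ∘ f)) →
      Sum.elim (x : Fin n → M) (Sum.elim (b : Fin n → M) e ∘ f) ∈ S := fun f S hS hev => by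
    have hcomp : ∀ y : Fin n → M, Sum.elim y (Sum.elim (b : Fin n → M) e) ∘ Sum.map id f =
        Sum.elim y (Sum.elim (b : Fin n → M) e ∘ f) := fun y => by
      funext z
      rcases z with z | z <;> rfl
    have := hx _ (hS.preimage_comp (Sum.map id f)) (hev.mono fun y hy => by
      simpa [fiber, hcomp] using hy)
    simpa [fiber, hcomp] using this
  obtain ⟨j, hj⟩ := himp x (forall_tp_realize_iff.2 (typeEq_of_imp fun S hS ha => by
    rcases h.rightEventual_or hS (b : Fin n → M) with hev | hev
    · exact hgen Sum.inl hS hev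
    · exact absurd ha (triangle_iff.1 hba _ hS.compl hev)))
  have hdef : A.Definable L {w | (φ j).Realize w} :=
    (Set.empty_definable_iff.2 ⟨φ j, rfl⟩).mono (Set.empty_subset A)
  exact hgen (fun i => Sum.inr ⟨j, i⟩) hdef.compl
    ((h.rightEventual_or hdef (d j)).resolve_left (h.not_rightEventual_of_divides (hdiv j))) hj

/-- Any pair of points of the locus has infinitely many pairwise disjoint conjugates over `A`, each
lying entirely above the preceding ones. -/
theorem exists_disjoint_conjugates (h : IsLargeSoPair p lt) {α β : locus p} (hαβ : lt α β) :
    ∃ u v : ℕ → locus p, (∀ i, TypeEq L A (Sum.elim (α : Fin n → M) (β : Fin n → M))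
      (Sum.elim (u i : Fin n → M) (v i : Fin n → M))) ∧ ∀ i j, i < j → lt (v i) (u j) := by
  obtain ⟨D, hD, hlt⟩ := h.definable
  let J := {w : locus p × locus p // TypeEq L A (Sum.elim (α : Fin n → M) (β : Fin n → M))
    (Sum.elim (w.1 : Fin n → M) (w.2 : Fin n → M))}
  have hJ : ∀ w : J, lt w.1.1 w.1.2 := fun w => (hlt _ _).2 ((w.2 D hD).1 ((hlt _ _).1 hαβ))
  have hstep : ∀ w : J, ∃ w' : J, lt w.1.2 w'.1.1 := fun w => by
    obtain ⟨u, hu⟩ := h.exists_gt w.1.2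
    obtain ⟨v, hv⟩ := h.monster.exists_typeEq_elim h.small
      (typeEq_of_mem_locus α.2 u.2) (β : Fin n → M)
    refine ⟨⟨⟨u, v, mem_locus_of_typeEq β.2 (hv.comp Sum.inl)⟩, ?_⟩, hu⟩
    have := hv.comp (Sum.elim Sum.inr Sum.inl)
    simpa [Sum.comp_elim] using this
  choose next hnext using hstep
  let s : ℕ → J := fun i => next^[i] ⟨(α, β), fun _ _ => Iff.rfl⟩
  have hs : ∀ i, lt (s i).1.2 (s (i + 1)).1.1 := fun i => by
    simp only [s, Function.iterate_succ_apply']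
    exact hnext _
  have htrans : IsTrans J fun w w' => lt w.1.2 w'.1.1 :=
    ⟨fun a b c hab hbc => h.trans hab (h.trans (hJ b) hbc)⟩
  exact ⟨fun i => (s i).1.1, fun i => (s i).1.2, fun i => (s i).2, fun i j hij =>
    Nat.rel_of_forall_rel_succ_of_lt (fun w w' : J => lt w.1.2 w'.1.1) hs hij⟩

/-- If the realizations of `tp(a/Ab)` are confined to a bounded interval of the locus, then the type
forks: the interval has pairwise disjoint conjugates. -/
theorem forkRel_of_bounded (h : IsLargeSoPair p lt) {a b α β : locus p}
    (H : ∀ x : locus p, TypeEq L A (Sum.elim (a : Fin n → M) (b : Fin n → M))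
      (Sum.elim (x : Fin n → M) (b : Fin n → M)) → lt α x ∧ lt x β) : ForkRel p a b := by
  obtain ⟨D, Θ, hD, hΘ, hp, hlt, hirr, htrans⟩ := h.exists_definable_order
  have hαβ : lt α β := h.trans (H a fun _ _ => Iff.rfl).1 (H a fun _ _ => Iff.rfl).2
  let X : Set (Fin n ⊕ (Fin n ⊕ Fin n) → M) :=
    {w | w ∘ Sum.inl ∈ Θ} ∩ ({w | w ∘ Sum.elim (Sum.inr ∘ Sum.inl) Sum.inl ∈ D} ∩
      {w | w ∘ Sum.elim Sum.inl (Sum.inr ∘ Sum.inr) ∈ D})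
  have hX : A.Definable L X := (hΘ.preimage_comp _).inter
    ((hD.preimage_comp _).inter (hD.preimage_comp _))
  have hXmem : ∀ x y z : Fin n → M, Sum.elim x (Sum.elim y z) ∈ X ↔
      x ∈ Θ ∧ Sum.elim y x ∈ D ∧ Sum.elim x z ∈ D := fun x y z => by
    simp [X, Sum.comp_elim, elim_comp_inr_comp]
  -- dividing is about formulas without hidden parameters, so those from `A` join the tuple
  obtain ⟨k, d, φ, hd, hφ⟩ := exists_formula_tuple hX
  obtain ⟨m, ⟨e⟩⟩ := Finite.exists_equiv_fin ((Fin n ⊕ Fin n) ⊕ Fin k)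
  let ψ : L.Formula (Fin n ⊕ Fin m) := φ.relabel
    (Sum.elim (Sum.elim Sum.inl (Sum.inr ∘ e ∘ Sum.inl)) (Sum.inr ∘ e ∘ Sum.inr))
  have hψ : ∀ x y z : Fin n → M,
      ψ.Realize (Sum.elim x (Sum.elim (Sum.elim y z) d ∘ e.symm)) ↔
        x ∈ Θ ∧ Sum.elim y x ∈ D ∧ Sum.elim x z ∈ D := fun x y z => by
    rw [← hXmem, hφ, Formula.realize_relabel]
    refine iff_of_eq (congrArg _ ?_)
    funext i
    rcases i with (i | i) | i <;> simp
  obtain ⟨u, v, huv, hlt'⟩ := h.exists_disjoint_conjugates hαβ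
  refine ⟨1, fun _ => m, fun _ => ψ, fun _ =>
    Sum.elim (Sum.elim (α : Fin n → M) (β : Fin n → M)) d ∘ e.symm, fun _ => ?_, fun x hx => ⟨0, ?_⟩⟩
  · refine ⟨fun i => Sum.elim (Sum.elim (u i : Fin n → M) (v i : Fin n → M)) d ∘ e.symm, 2,
      fun i => sameType_iff_typeEq.2 (((huv i).elim_right hd).comp _), ?_⟩
    rintro s hs ⟨x, hx⟩
    obtain ⟨i, j, hij, rfl⟩ := Finset.card_eq_two.1 hs
    have hi := (hψ _ _ _).1 (hx i (by simp))
    have hj := (hψ _ _ _).1 (hx j (by simp))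
    -- `x < v i < u j < x` when `i < j`
    have key : ∀ i j : ℕ, i < j → Sum.elim x (v i : Fin n → M) ∈ D →
        Sum.elim (u j : Fin n → M) x ∈ D → False := fun i j hij hxi hjx =>
      hirr x hi.1 (htrans _ hi.1 _ (hp (u j).2) _ hi.1
        (htrans _ hi.1 _ (hp (v i).2) _ (hp (u j).2) hxi ((hlt _ _).1 (hlt' i j hij))) hjx)
    rcases lt_or_gt_of_ne hij with hij | hij
    · exact key i j hij hi.2.2 hj.2.1
    · exact key j i hij hj.2.2 hi.2.1
  · have hx := forall_tp_realize_iff.1 hx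
    have hxp : x ∈ locus p := mem_locus_of_typeEq a.2 (hx.comp Sum.inl)
    obtain ⟨h₁, h₂⟩ := H ⟨x, hxp⟩ hx
    exact (hψ _ _ _).2 ⟨hp hxp, (hlt _ _).1 h₁, (hlt _ _).1 h₂⟩

theorem forkRel_of_incomparable (h : IsLargeSoPair p lt) {a b : locus p}
    (hab : Incomparable (Triangle p lt) a b) : ForkRel p a b := by
  obtain ⟨β, hβ⟩ : ∃ β, Triangle p lt b β := h.exists_rightGeneric _
  obtain ⟨α, hα⟩ : ∃ α, Triangle p (fun a b => lt b a) b α := h.reverse.exists_rightGeneric _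
  refine h.forkRel_of_bounded (α := α) (β := β) fun x hx => ⟨?_, ?_⟩
  · by_contra hcon
    refine hab.1 (h.triangle_of_reverse (triangle_of_typeEq hx ?_))
    rcases h.trichotomy α x with hl | rfl | hl
    · exact absurd hl hcon
    · exact hα
    · exact h.reverse.triangle_of_triangle_of_lt hα hl
  · by_contra hcon
    refine hab.2 (triangle_of_typeEq hx ?_)
    rcases h.trichotomy x β with hl | rfl | hl
    · exact absurd hl hcon
    · exact hβ
    · exact h.triangle_of_triangle_of_lt hβ hl

theorem forkRel_iff_incomparable (h : IsLargeSoPair p lt) (a b : locus p) :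
    ForkRel p a b ↔ Incomparable (Triangle p lt) a b :=
  ⟨fun hf => ⟨fun hab => h.reverse.not_forkRel_of_triangle (h.triangle_reverse hab) hf,
    fun hba => h.not_forkRel_of_triangle hba hf⟩, h.forkRel_of_incomparable⟩

end IsLargeSoPair

end Forking

/-! ### The quotient by forking dependence -/

section Quotient

variable {L : FirstOrder.Language.{u, v}} {M : Type w} [L.Structure M] {A : Set M} {n : ℕ}
  {p : TypeOver L A n} {lt : locus p → locus p → Prop}

namespace IsLargeSoPair

theorem isStrictOrder_triangle (h : IsLargeSoPair p lt) :
    IsStrictOrder (locus p) (Triangle p lt) where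
  irrefl a ha := h.irrefl a (h.lt_of_triangle ha)
  trans _ _ _ hab hbc := h.triangle_of_triangle_of_lt hab (h.lt_of_triangle hbc)

theorem equivalence_forkRel (h : IsLargeSoPair p lt) : Equivalence (ForkRel p) where
  refl a := (h.forkRel_iff_incomparable a a).2
    ⟨fun ha => h.irrefl a (h.lt_of_triangle ha), fun ha => h.irrefl a (h.lt_of_triangle ha)⟩
  symm hab := (h.forkRel_iff_incomparable _ _).2 ((h.forkRel_iff_incomparable _ _).1 hab).symm
  trans hab hbc := by
    rw [h.forkRel_iff_incomparable] at hab hbc ⊢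
    exact ⟨fun hac => (h.triangle_or_triangle hac _).elim hab.1 hbc.1,
      fun hca => (h.triangle_or_triangle hca _).elim hbc.2 hab.2⟩

theorem isConvexRel_forkRel (h : IsLargeSoPair p lt) : IsConvexRel lt (ForkRel p) := by
  intro x a ha b hb c hac hcb
  simp only [Set.mem_ofPred_eq, h.forkRel_iff_incomparable] at ha hb ⊢
  exact ⟨fun hxc => hb.1 (h.triangle_of_triangle_of_lt hxc hcb),
    fun hcx => ha.2 (h.triangle_of_lt_of_triangle hac hcx)⟩

theorem quotientLT_mk_iff (h : IsLargeSoPair p lt) (hE : Equivalence (ForkRel p))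
    (a b : locus p) :
    quotientLT lt ⟨ForkRel p, hE⟩ (Quotient.mk _ a) (Quotient.mk _ b) ↔ Triangle p lt a b := by
  constructor
  · intro hq
    by_contra hab
    by_cases hba : Triangle p lt b a
    · exact h.asymm (h.lt_of_triangle hba) (hq a b rfl rfl)
    · exact h.irrefl a (hq a a rfl (Quotient.sound
        (show ForkRel p a b from (h.forkRel_iff_incomparable a b).2 ⟨hab, hba⟩)))
  · intro hab y z hy hz
    have hya := (h.forkRel_iff_incomparable y a).1 (Quotient.exact hy)
    have hzb := (h.forkRel_iff_incomparable z b).1 (Quotient.exact hz)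
    have hyb := (h.triangle_or_triangle hab y).resolve_left hya.2
    exact h.lt_of_triangle ((h.triangle_or_triangle hyb z).resolve_right hzb.1)

end IsLargeSoPair

end Quotient

end SoType

theorem theorem4 {L : FirstOrder.Language.{u, v}} {M : Type w} [L.Structure M]
    (hM : SoType.IsMonster L M) (A : Set M) (hA : Cardinal.mk A < Cardinal.mk M) {n : ℕ}
    (p : SoType.TypeOver L A n) (lt : SoType.locus p → SoType.locus p → Prop)
    (hp : SoType.IsSoPair p lt) (hna : SoType.NonAlgebraic p) :
    -- right genericity is a strict partial order, linearly extended by `lt`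
    (IsStrictOrder (SoType.locus p) (SoType.Triangle p lt) ∧
      IsStrictTotalOrder (SoType.locus p) lt ∧
      ∀ a b : SoType.locus p, SoType.Triangle p lt a b → lt a b) ∧
    -- forking dependence is incomparability, and it is a convex equivalence relation
    (∀ a b : SoType.locus p,
      SoType.ForkRel p a b ↔ SoType.Incomparable (SoType.Triangle p lt) a b) ∧
    ∃ hE : Equivalence (SoType.ForkRel p),
      SoType.IsConvexRel lt (SoType.ForkRel p) ∧
      -- the quotient is a dense linear order with more than one element
      IsStrictTotalOrder (Quotient ⟨SoType.ForkRel p, hE⟩)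
        (SoType.quotientLT lt ⟨SoType.ForkRel p, hE⟩) ∧
      Nontrivial (Quotient ⟨SoType.ForkRel p, hE⟩) ∧
      ∀ Y Z : Quotient ⟨SoType.ForkRel p, hE⟩,
        SoType.quotientLT lt ⟨SoType.ForkRel p, hE⟩ Y Z →
        ∃ W : Quotient ⟨SoType.ForkRel p, hE⟩,
          SoType.quotientLT lt ⟨SoType.ForkRel p, hE⟩ Y W ∧
          SoType.quotientLT lt ⟨SoType.ForkRel p, hE⟩ W Z := by
  have h : SoType.IsLargeSoPair p lt := { hp with monster := hM, small := hA, nonAlgebraic := hna }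
  have hE := h.equivalence_forkRel
  have hq := h.quotientLT_mk_iff hE
  have hso := h.isStrictOrder_triangle
  refine ⟨⟨hso, hp.linear, fun a b => h.lt_of_triangle⟩, h.forkRel_iff_incomparable, hE,
    h.isConvexRel_forkRel, ?_, ?_, ?_⟩
  · refine { irrefl := ?irrefl, trans := ?trans, trichotomous := ?tri }
    case irrefl =>
      rintro ⟨a⟩ ha
      exact hso.irrefl a ((hq a a).1 ha)
    case trans =>
      rintro ⟨a⟩ ⟨b⟩ ⟨c⟩ hab hbc
      exact (hq a c).2 (hso.trans a b c ((hq a b).1 hab) ((hq b c).1 hbc))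
    case tri =>
      rintro ⟨a⟩ ⟨b⟩ hab hba
      exact Quotient.sound (show SoType.ForkRel p a b from (h.forkRel_iff_incomparable a b).2
        ⟨fun hl => hab ((hq a b).2 hl), fun hl => hba ((hq b a).2 hl)⟩)
  · obtain ⟨x, hx⟩ := (show (SoType.locus p).Infinite from hna).nonempty
    obtain ⟨b, hb⟩ : ∃ b, SoType.Triangle p lt ⟨x, hx⟩ b := h.exists_rightGeneric _
    exact ⟨Quotient.mk _ ⟨x, hx⟩, Quotient.mk _ b, fun he =>
      ((h.forkRel_iff_incomparable _ _).1 (Quotient.exact he)).1 hb⟩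
  · rintro ⟨a⟩ ⟨b⟩ hab
    obtain ⟨c, hac, hcb⟩ := h.exists_triangle_between ((hq a b).1 hab)
    exact ⟨Quotient.mk _ c, (hq a c).2 hac, (hq c b).2 hcb⟩
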